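/- Let $G$ be a second-countable locally compact group, let $A$ be a separable and $B$ a $\sigma$-unital $C^*$-algebra, and let $\alpha: G\curvearrowright A$ and $\beta: G\curvearrowright B$ be point-norm continuous actions by $*$-automorphisms. Write $\beta_g$ also for the canonical extension of $\beta_g$ to the multiplier algebra $\mathcal M(B)$. A cocycle representation $(\varphi,\mathbb u):(A,\alpha)\to(\mathcal M(B),\beta)$ consists of a $*$-homomorphism $\varphi: A\to\mathcal M(B)$ and a strictly continuous map $\mathbb u: G\to\mathcal U(\mathcal M(B))$ with $\mathbb u_{gh}=\mathbb u_g\beta_g(\mathbb u_h)$ for all $g,h\in G$ and $\mathbb u_g\beta_g(\varphi(a))\mathbb u_g^*=\varphi(\alpha_g(a))$ for all $g\in G$, $a\in A$. Let $D_{(\varphi,\mathbb u)}$ be the unital $C^*$-subalgebra of all $x\in\mathcal M(B)$ such that $x-\mathbb u_g\beta_g(x)\mathbb u_g^*\in B$ for all $g\in G$ and $x\varphi(a)-\varphi(a)x\in B$ for all $a\in A$. Two cocycle representations $(\varphi,\mathbb u),(\psi,\mathbb v):(A,\alpha)\to(\mathcal M(B),\beta)$ are called operator homotopic if there is a unitary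 $w$ in the norm-connected component of $1$ in the unitary group of $D_{(\varphi,\mathbb u)}$ such that $\psi(a)=w\varphi(a)w^*$ for all $a\in A$ and $\mathbb v_g=w\mathbb u_g\beta_g(w)^*$ for all $g\in G$. Let $(\varphi,\mathbb u),(\psi,\mathbb v):(A,\alpha)\to(\mathcal M(B),\beta)$ be operator homotopic cocycle representations. Then they are strongly asymptotically unitarily equivalent: writing $\mathcal U(1+B)$ for the set of unitaries with scalar part $1$ in the $C^*$-algebra obtained from $B$ by adjoining a new unit, mapped canonically to $\mathcal M(B)$, there is a norm-continuous path $w:[0,\infty)\to\mathcal U(1+B)$ with $w_0=1$ such that \[ \lim_{t\to\infty}\|\psi(a)-w_t\varphi(a)w_t^*\|=0 \quad\text{for all } a\in A \] and \[ \lim_{t\to\infty}\ \sup_{g\in K}\|\mathbb v_g-w_t\mathbb u_g\beta_g(w_t)^*\|=0 \quad\text{for every compact set } K\subseteq G. \] -/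

import Mathlib

open Filter Topology
open scoped NNReal MultiplierAlgebra

noncomputable section

namespace CocycleRepresentations

/-- A C⋆-algebra is σ-unital if it has a sequential approximate unit, i.e. an increasing sequence
of positive contractions `e n` with `e n * b → b` and `b * e n → b` in norm for all `b`. -/
def IsSigmaUnital (B : Type*) [NonUnitalCStarAlgebra B] : Prop :=
  letI := CStarAlgebra.spectralOrder B
  ∃ e : ℕ → B, Monotone e ∧ (∀ n, 0 ≤ e n ∧ ‖e n‖ ≤ 1) ∧
    ∀ b : B, Tendsto (fun n => e n * b) atTop (𝓝 b) ∧ Tendsto (fun n => b * e n) atTop (𝓝 b)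

/-- A point-norm continuous action of a topological group on a C⋆-algebra by
⋆-automorphisms. -/
structure ContAction (G : Type*) [Group G] [TopologicalSpace G]
    (A : Type*) [NonUnitalCStarAlgebra A] where
  /-- The homomorphism into the automorphism group. -/
  aut : G →* (A ≃⋆ₐ[ℂ] A)
  /-- Continuity of all orbit maps for the norm. -/
  continuous_orbit : ∀ a : A, Continuous fun g => aut g a

section Multipliers

variable {B : Type*} [NonUnitalCStarAlgebra B]

/-- A ⋆-automorphism of a C⋆-algebra as a continuous linear map. -/
def autCLM (σ : B ≃⋆ₐ[ℂ] B) : B →L[ℂ] B where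
  toFun := σ
  map_add' := map_add σ
  map_smul' := map_smul σ
  cont := (NonUnitalStarAlgHom.isometry σ σ.injective).continuous

@[simp] lemma autCLM_apply (σ : B ≃⋆ₐ[ℂ] B) (b : B) : autCLM σ b = σ b := rfl

lemma multiplier_ext {x y : 𝓜(ℂ, B)} (h₁ : ∀ b, x.fst b = y.fst b)
    (h₂ : ∀ b, x.snd b = y.snd b) : x = y :=
  DoubleCentralizer.ext _ _ _ _ (Prod.ext (ContinuousLinearMap.ext h₁) (ContinuousLinearMap.ext h₂))

/-- The canonical extension of a ⋆-automorphism `σ` of `B` to the multiplier algebra of `B`: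
`σ(x) b = σ (x σ⁻¹(b))` and `b σ(x) = σ (σ⁻¹(b) x)`. -/
def multiplierExt (σ : B ≃⋆ₐ[ℂ] B) : 𝓜(ℂ, B) →⋆ₐ[ℂ] 𝓜(ℂ, B) where
  toFun x :=
    { fst := (autCLM σ).comp (x.fst.comp (autCLM σ.symm))
      snd := (autCLM σ).comp (x.snd.comp (autCLM σ.symm))
      central := fun a b => by
        have h := congrArg σ (x.central (σ.symm a) (σ.symm b))
        simpa using h }
  map_one' := multiplier_ext (fun b => by simp) (fun b => by simp)
  map_mul' x y := multiplier_ext (fun b => by simp) (fun b => by simp)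
  map_zero' := multiplier_ext (fun b => by simp) (fun b => by simp)
  map_add' x y := multiplier_ext (fun b => by simp) (fun b => by simp)
  commutes' c := multiplier_ext
    (fun b => by simp [Algebra.algebraMap_eq_smul_one])
    (fun b => by simp [Algebra.algebraMap_eq_smul_one])
  map_star' x := multiplier_ext (fun b => by simp [map_star]) (fun b => by simp [map_star])

/-- The copy of `B` inside its multiplier algebra. -/
def baseIdeal (B : Type*) [NonUnitalCStarAlgebra B] : NonUnitalStarSubalgebra ℂ 𝓜(ℂ, B) :=
  NonUnitalStarAlgHom.range (DoubleCentralizer.coeHom (𝕜 := ℂ) (A := B))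

lemma mul_mem_baseIdeal (x : 𝓜(ℂ, B)) {y : 𝓜(ℂ, B)} (hy : y ∈ baseIdeal B) :
    x * y ∈ baseIdeal B := by
  obtain ⟨b, rfl⟩ := hy
  refine ⟨x.fst b, multiplier_ext (fun c => ?_) (fun c => ?_)⟩
  · change x.fst b * c = x.fst (b * c)
    rw [← sub_eq_zero, ← CStarRing.star_mul_self_eq_zero_iff]
    generalize star (x.fst b * c - x.fst (b * c)) = d
    rw [mul_sub, ← mul_assoc, ← x.central, ← x.central, mul_assoc, sub_self]
  · exact (x.central c b).symm

lemma mem_baseIdeal_mul {y : 𝓜(ℂ, B)} (hy : y ∈ baseIdeal B) (x : 𝓜(ℂ, B)) :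
    y * x ∈ baseIdeal B := by
  simpa using star_mem (mul_mem_baseIdeal (star x) (star_mem hy))

/-- The proper unitization of `B` (a new unit is added even if `B` is unital) mapped canonically
to the multiplier algebra, `(c, b) ↦ c 1 + b`. -/
def unitizationToMultiplier (B : Type*) [NonUnitalCStarAlgebra B] :
    Unitization ℂ B →⋆ₐ[ℂ] 𝓜(ℂ, B) :=
  Unitization.starLift (DoubleCentralizer.coeHom (𝕜 := ℂ) (A := B))

/-- The set `U(1 + B)` of all unitaries in the proper unitization of `B` with scalar part `1`. -/
def unitariesOnePlus (B : Type*) [NonUnitalCStarAlgebra B] : Set (unitary (Unitization ℂ B)) :=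
  {u | (u : Unitization ℂ B).fst = 1}

end Multipliers

variable {G : Type*} [Group G] [TopologicalSpace G]
variable {A : Type*} [NonUnitalCStarAlgebra A] {B : Type*} [NonUnitalCStarAlgebra B]

/-- A cocycle representation `(φ, u) : (A, α) → (M(B), β)`. -/
structure CocycleRep (α : ContAction G A) (β : ContAction G B) where
  /-- The ⋆-homomorphism `φ : A → M(B)`. -/
  hom : A →⋆ₙₐ[ℂ] 𝓜(ℂ, B)
  /-- The unitary cocycle `u : G → U(M(B))`. -/
  coc : G → unitary 𝓜(ℂ, B)
  /-- Strict continuity of the cocycle: `g ↦ u_g b` is norm-continuous for all `b ∈ B`. -/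
  continuous_coc_mul : ∀ b : B, Continuous fun g => (coc g : 𝓜(ℂ, B)).fst b
  /-- Strict continuity of the cocycle: `g ↦ b u_g` is norm-continuous for all `b ∈ B`. -/
  continuous_mul_coc : ∀ b : B, Continuous fun g => (coc g : 𝓜(ℂ, B)).snd b
  /-- The cocycle identity `u_{gh} = u_g β_g(u_h)`. -/
  coc_mul : ∀ g h : G, (coc (g * h) : 𝓜(ℂ, B)) = coc g * multiplierExt (β.aut g) (coc h)
  /-- Equivariance `Ad(u_g) ∘ β_g ∘ φ = φ ∘ α_g`. -/
  equivariant : ∀ (g : G) (a : A),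
    (coc g : 𝓜(ℂ, B)) * multiplierExt (β.aut g) (hom a) * star (coc g : 𝓜(ℂ, B))
      = hom (α.aut g a)

namespace CocycleRep

variable {α : ContAction G A} {β : ContAction G B}

/-- The cocycle perturbed action `β^u_g = Ad(u_g) ∘ β_g`, on the multiplier algebra. -/
def perturbed (ρ : CocycleRep α β) (g : G) (x : 𝓜(ℂ, B)) : 𝓜(ℂ, B) :=
  (ρ.coc g : 𝓜(ℂ, B)) * multiplierExt (β.aut g) x * star (ρ.coc g : 𝓜(ℂ, B))

lemma perturbed_algebraMap (ρ : CocycleRep α β) (g : G) (c : ℂ) :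
    ρ.perturbed g (algebraMap ℂ _ c) = algebraMap ℂ _ c := by
  rw [perturbed, AlgHomClass.commutes, ← Algebra.commutes, mul_assoc, Unitary.mul_star_self_of_mem (ρ.coc g).2,
    mul_one]

lemma perturbed_add (ρ : CocycleRep α β) (g : G) (x y : 𝓜(ℂ, B)) :
    ρ.perturbed g (x + y) = ρ.perturbed g x + ρ.perturbed g y := by
  simp [perturbed, mul_add, add_mul]

lemma perturbed_mul (ρ : CocycleRep α β) (g : G) (x y : 𝓜(ℂ, B)) :
    ρ.perturbed g (x * y) = ρ.perturbed g x * ρ.perturbed g y := by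
  have h : star (ρ.coc g : 𝓜(ℂ, B)) * (ρ.coc g : 𝓜(ℂ, B)) = 1 := Unitary.coe_star_mul_self _
  simp only [perturbed, map_mul]
  calc _ = (ρ.coc g : 𝓜(ℂ, B)) * multiplierExt (β.aut g) x * 1 * multiplierExt (β.aut g) y
        * star (ρ.coc g : 𝓜(ℂ, B)) := by simp only [mul_one, mul_assoc]
    _ = _ := by rw [← h]; simp only [mul_assoc]

lemma perturbed_star (ρ : CocycleRep α β) (g : G) (x : 𝓜(ℂ, B)) :
    ρ.perturbed g (star x) = star (ρ.perturbed g x) := by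
  simp [perturbed, map_star, mul_assoc]

/-- The C⋆-algebra `D_{(φ,u)}` of all `x ∈ M(B)` such that `x - β^u_g(x) ∈ B` for all `g ∈ G` and
`x φ(a) - φ(a) x ∈ B` for all `a ∈ A`. -/
def dAlg (ρ : CocycleRep α β) : StarSubalgebra ℂ 𝓜(ℂ, B) where
  carrier := {x | (∀ g : G, x - ρ.perturbed g x ∈ baseIdeal B) ∧
    ∀ a : A, x * ρ.hom a - ρ.hom a * x ∈ baseIdeal B}
  mul_mem' := by
    rintro x y ⟨hx, hx'⟩ ⟨hy, hy'⟩
    refine ⟨fun g => ?_, fun a => ?_⟩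
    · have h := add_mem (mem_baseIdeal_mul (hx g) y)
        (mul_mem_baseIdeal (ρ.perturbed g x) (hy g))
      rw [perturbed_mul]
      convert h using 1
      noncomm_ring
    · have h := add_mem (mul_mem_baseIdeal x (hy' a)) (mem_baseIdeal_mul (hx' a) y)
      convert h using 1
      noncomm_ring
  add_mem' := by
    rintro x y ⟨hx, hx'⟩ ⟨hy, hy'⟩
    refine ⟨fun g => ?_, fun a => ?_⟩
    · rw [perturbed_add, add_sub_add_comm]
      exact add_mem (hx g) (hy g)
    · rw [add_mul, mul_add, add_sub_add_comm]
      exact add_mem (hx' a) (hy' a)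
  algebraMap_mem' c := by
    refine ⟨fun g => ?_, fun a => ?_⟩
    · rw [perturbed_algebraMap, sub_self]
      exact zero_mem _
    · rw [Algebra.commutes, sub_self]
      exact zero_mem _
  star_mem' := by
    rintro x ⟨hx, hx'⟩
    refine ⟨fun g => ?_, fun a => ?_⟩
    · rw [perturbed_star, ← star_sub]
      exact star_mem (hx g)
    · have h := neg_mem (star_mem (hx' (star a)))
      rw [star_sub, star_mul, star_mul, map_star, star_star, neg_sub] at h
      exact h

/-- `(φ, u)` and `(ψ, v)` are operator homotopic: there is a unitary `w` in the norm-connected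
component of `1` in the unitary group of `D_{(φ,u)}` with `ψ = Ad(w) ∘ φ` and
`v_g = w u_g β_g(w)⋆` for all `g ∈ G`. -/
def OperatorHomotopic (ρ₀ ρ₁ : CocycleRep α β) : Prop :=
  ∃ w : unitary ρ₀.dAlg, w ∈ connectedComponent (1 : unitary ρ₀.dAlg) ∧
    (∀ a : A, ρ₁.hom a = ((w : ρ₀.dAlg) : 𝓜(ℂ, B)) * ρ₀.hom a *
      star ((w : ρ₀.dAlg) : 𝓜(ℂ, B))) ∧
    ∀ g : G, (ρ₁.coc g : 𝓜(ℂ, B)) = ((w : ρ₀.dAlg) : 𝓜(ℂ, B)) * ρ₀.coc g *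
      star (multiplierExt (β.aut g) ((w : ρ₀.dAlg) : 𝓜(ℂ, B)))

/-- `(φ, u)` and `(ψ, v)` are strongly asymptotically unitarily equivalent: there is a
norm-continuous path `w : [0,∞) → U(1 + B)` with `w_0 = 1` such that `w_t φ(a) w_t⋆ → ψ(a)` for all
`a ∈ A`, and `w_t u_g β_g(w_t)⋆ → v_g` uniformly in `g` on each compact subset of `G`. -/
def StronglyAsymptoticallyUnitarilyEquivalent (ρ₀ ρ₁ : CocycleRep α β) : Prop :=
  ∃ w : ℝ≥0 → unitary (Unitization ℂ B),
    Continuous w ∧ (∀ t, w t ∈ unitariesOnePlus B) ∧ w 0 = 1 ∧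
    (∀ a : A, Tendsto (fun t => ‖ρ₁.hom a - unitizationToMultiplier B (w t) * ρ₀.hom a *
      star (unitizationToMultiplier B (w t))‖) atTop (𝓝 0)) ∧
    ∀ K : Set G, IsCompact K → ∀ ε > (0 : ℝ), ∀ᶠ t in atTop, ∀ g ∈ K,
      ‖(ρ₁.coc g : 𝓜(ℂ, B)) - unitizationToMultiplier B (w t) * ρ₀.coc g *
        star (multiplierExt (β.aut g) (unitizationToMultiplier B (w t)))‖ < ε

end CocycleRep

end CocycleRepresentations

end

/-!
Let `γ` be the perturbed action `β^u` on `M(B)`. For a selfadjoint `h ∈ D` and a path `p` of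
selfadjoint contractions in `B` from `0` to an approximate unit that is quasicentral for `φ(A)` and
asymptotically `γ`-invariant, the compression `(1 - p_t) h (1 - p_t)` starts at `h`, stays in
`h + B`, and asymptotically commutes with `φ(A)` and is asymptotically `γ`-invariant, because the
corresponding defects of `h` lie in `B` and are annihilated in the limit. Exponentiating gives a
path with these properties in `exp(ih) + B` starting at `exp(ih)`. Every unitary in the component
of `1` is a finite product of exponentials, so there is such a path `x` starting at `w⋆`, and
`w x_t` is the required path in `U(1 + B)`.

Uniformity over compact sets of `G` needs `g ↦ γ_g(h)` to be norm-continuous. For an approximate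
unit `e` of `B`, each `g ↦ (h - γ_g(h)) e_n` is, so a Baire category argument gives a point of small
oscillation of the limit `g ↦ h - γ_g(h)`, and translation in `G` moves it everywhere.
-/

noncomputable section

namespace CocycleRepresentations

open DoubleCentralizer

open NormedSpace in
lemma norm_expUnitary_mul_sub_mul_expUnitary_le {M : Type*} [CStarAlgebra M]
    (X Y : selfAdjoint M) (c : M) :
    ‖(selfAdjoint.expUnitary X : M) * c - c * selfAdjoint.expUnitary Y‖ ≤
      ‖(X : M) * c - c * Y‖ := by
  let f : ℝ → M := fun s => selfAdjoint.expUnitary (s • X) * c * selfAdjoint.expUnitary (s • -Y)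
  have hexp (Z : selfAdjoint M) (s : ℝ) :
      (selfAdjoint.expUnitary (s • Z) : M) = exp (s • (Complex.I • (Z : M))) := by
    rw [selfAdjoint.expUnitary_coe, selfAdjoint.val_smul, smul_comm]
  have hderiv (s : ℝ) : HasDerivAt f (selfAdjoint.expUnitary (s • X) *
      (Complex.I • ((X : M) * c - c * Y)) * selfAdjoint.expUnitary (s • -Y)) s := by
    simp only [f, hexp]
    refine (((hasDerivAt_exp_smul_const (Complex.I • (X : M)) s).mul_const c).mul
      (hasDerivAt_exp_smul_const' (Complex.I • ((-Y : selfAdjoint M) : M)) s)).congr_deriv ?_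
    simp only [NegMemClass.coe_neg, smul_neg, smul_add, mul_smul_comm, smul_mul_assoc, mul_add,
      add_mul, mul_neg, neg_mul, mul_assoc, sub_eq_add_neg]
  have hbound := norm_image_sub_le_of_norm_deriv_le_segment_01'
    (fun s _ => (hderiv s).hasDerivWithinAt) (C := ‖(X : M) * c - c * Y‖) fun s _ => by
      rw [CStarRing.norm_mul_coe_unitary, CStarRing.norm_coe_unitary_mul, norm_smul,
        Complex.norm_I, one_mul]
  have hinv : selfAdjoint.expUnitary (-Y) * selfAdjoint.expUnitary Y = 1 := by
    rw [← Commute.expUnitary_add (Commute.refl (Y : M)).neg_left, neg_add_cancel,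
      selfAdjoint.expUnitary_zero]
  have hcancel : (f 1 - f 0) * selfAdjoint.expUnitary Y =
      selfAdjoint.expUnitary X * c - c * selfAdjoint.expUnitary Y := by
    simp only [f, one_smul, zero_smul, selfAdjoint.expUnitary_zero, OneMemClass.coe_one, one_mul,
      mul_one, sub_mul, mul_assoc]
    rw [← Submonoid.coe_mul, hinv, OneMemClass.coe_one, mul_one]
  rwa [← hcancel, CStarRing.norm_mul_coe_unitary]

section AlmostOrthogonal

variable {R : Type*} [NonUnitalNormedRing R] [StarRing R] [CStarRing R]

lemma sq_norm_sum_le_of_almost_orthogonal {κ : Type*} (s : Finset κ) {d : κ → R}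
    {C δ : ℝ} (hC : ∀ i, ‖d i‖ ≤ C) (hδ : 0 ≤ δ) (hd : Pairwise fun i j => ‖star (d i) * d j‖ ≤ δ) :
    ‖∑ i ∈ s, d i‖ ^ 2 ≤ s.card * C ^ 2 + s.card ^ 2 * δ := by
  classical
  have hterm (i j : κ) : ‖star (d i) * d j‖ ≤ (if i = j then C ^ 2 else 0) + δ := by
    split_ifs with h
    · rw [h, CStarRing.norm_star_mul_self, ← sq]
      exact le_add_of_le_of_nonneg (pow_le_pow_left₀ (norm_nonneg _) (hC j) 2) hδ
    · simpa using hd h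
  calc ‖∑ i ∈ s, d i‖ ^ 2 = ‖∑ i ∈ s, ∑ j ∈ s, star (d i) * d j‖ := by
        rw [sq, ← CStarRing.norm_star_mul_self, star_sum, Finset.sum_mul_sum]
    _ ≤ ∑ i ∈ s, ∑ j ∈ s, ((if i = j then C ^ 2 else 0) + δ) :=
        norm_sum_le_of_le _ fun i _ => norm_sum_le_of_le _ fun j _ => hterm i j
    _ = s.card * C ^ 2 + s.card ^ 2 * δ := by
        simp [Finset.sum_add_distrib, Finset.sum_ite_eq, sq, mul_assoc]

lemma exists_subsequence_almost_orthogonal {ι : Type*} {S : Set ι} {d : ι → ℕ → R}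
    (horth : ∀ m, ∀ δ > 0, ∀ᶠ n in atTop, ∀ i ∈ S, ‖star (d i n) * d i m‖ ≤ δ)
    (N₀ : ℕ) {δ : ℝ} (hδ : 0 < δ) :
    ∃ k : ℕ → ℕ, (∀ j, N₀ ≤ k j) ∧
      ∀ i ∈ S, Pairwise fun j j' => ‖star (d i (k j)) * d i (k j')‖ ≤ δ := by
  obtain ⟨k, hk, hlt⟩ := exists_seq_of_forall_finset_exists (N₀ ≤ ·)
    (fun m n => ∀ i ∈ S, ‖star (d i n) * d i m‖ ≤ δ) fun s _ =>
      ((eventually_ge_atTop N₀).and <|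
        (Finset.eventually_all s).mpr fun m _ => horth m δ hδ).exists
  refine ⟨k, hk, fun i hi j j' hjj' => ?_⟩
  rcases hjj'.lt_or_gt with h | h
  · rw [← norm_star, star_mul, star_star]
    exact hlt j j' h i hi
  · exact hlt j' j h i hi

lemma exists_mem_convexHull_forall_norm_le [NormedSpace ℝ R] {E : Type*} [AddCommGroup E]
    [Module ℝ E] {ι : Type*} {S : Set ι} {T : ι → E →ₗ[ℝ] R} {e : ℕ → E} {C : ℝ}
    (hC : ∀ i ∈ S, ∀ n, ‖T i (e n)‖ ≤ C)
    (horth : ∀ m, ∀ δ > 0, ∀ᶠ n in atTop, ∀ i ∈ S, ‖star (T i (e n)) * T i (e m)‖ ≤ δ)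
    (N₀ : ℕ) {ε : ℝ} (hε : 0 < ε) :
    ∃ f ∈ convexHull ℝ (e '' Set.Ici N₀), ∀ i ∈ S, ‖T i f‖ ≤ ε := by
  have hδ : 0 < ε ^ 2 / 2 := by positivity
  obtain ⟨k, hk, hpair⟩ := exists_subsequence_almost_orthogonal horth N₀ hδ
  obtain ⟨N, hN⟩ := exists_nat_gt (C ^ 2 / (ε ^ 2 / 2))
  have hN0 : (0 : ℝ) < N := lt_of_le_of_lt (by positivity) hN
  refine ⟨∑ j ∈ Finset.range N, (N : ℝ)⁻¹ • e (k j),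
    (convex_convexHull ℝ _).sum_mem (fun _ _ => by positivity) (by simp [hN0.ne'])
      fun j _ => subset_convexHull ℝ _ ⟨k j, hk j, rfl⟩, fun i hi => ?_⟩
  have hsum : ‖∑ j ∈ Finset.range N, T i (e (k j))‖ ≤ N * ε := by
    refine le_of_sq_le_sq ((sq_norm_sum_le_of_almost_orthogonal _ (fun j => hC i hi (k j)) hδ.le
      (hpair i hi)).trans ?_) (by positivity)
    rw [div_lt_iff₀ hδ] at hN
    rw [Finset.card_range]
    nlinarith
  rw [← Finset.smul_sum, map_smul, map_sum, norm_smul, norm_inv, Real.norm_natCast]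
  exact inv_mul_le_of_le_mul₀ hN0.le hε.le hsum

end AlmostOrthogonal

lemma tendsto_mul_of_isBoundedUnder {R : Type*} [NormedRing R] {ι X : Type*} [TopologicalSpace X]
    {l : Filter ι} {q : ι → R} (hq : IsBoundedUnder (· ≤ ·) l fun i => ‖q i‖) {b : X → R} {x : X}
    (hb : ContinuousAt b x) (h : Tendsto (fun i => q i * b x) l (𝓝 0)) :
    Tendsto (fun p : ι × X => q p.1 * b p.2) (l ×ˢ 𝓝 x) (𝓝 0) := by
  have hsub : Tendsto (fun p : ι × X => b p.2 - b x) (l ×ˢ 𝓝 x) (𝓝 0) := by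
    simpa using (hb.tendsto.comp tendsto_snd).sub_const (b x)
  have hbdd : IsBoundedUnder (· ≤ ·) (l ×ˢ 𝓝 x) fun p : ι × X => ‖q p.1‖ :=
    tendsto_fst.isBoundedUnder_comp hq
  simpa [mul_sub] using
    (isBoundedUnder_le_mul_tendsto_zero hbdd hsub).add (h.comp (tendsto_fst (g := 𝓝 x)))

lemma eventually_forall_mem_of_isCompact {ι X : Type*} [TopologicalSpace X] {l : Filter ι}
    {K : Set X} (hK : IsCompact K) {P : ι × X → Prop} (h : ∀ x ∈ K, ∀ᶠ p in l ×ˢ 𝓝 x, P p) :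
    ∀ᶠ i in l, ∀ x ∈ K, P (i, x) := by
  have : ∀ᶠ p in l ×ˢ 𝓝ˢ K, P p := by
    simpa only [hK.prod_nhdsSet_eq_biSup, eventually_iSup] using h
  exact this.curry.mono fun i hi => hi.self_of_nhdsSet

lemma exists_eventually_dist_lt_of_tendsto {X Y : Type*} [TopologicalSpace X] [BaireSpace X]
    [Nonempty X] [PseudoMetricSpace Y] {f : ℕ → X → Y} {F : X → Y} (hf : ∀ n, Continuous (f n))
    (hF : ∀ x, Tendsto (fun n => f n x) atTop (𝓝 (F x))) {ε : ℝ} (hε : 0 < ε) :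
    ∃ x₀, ∀ᶠ x in 𝓝 x₀, dist (F x) (F x₀) < ε := by
  have hε4 : 0 < ε / 4 := by positivity
  let A : ℕ → Set X := fun N => {x | ∀ n ≥ N, dist (f n x) (f N x) ≤ ε / 4}
  have hclosed (N : ℕ) : IsClosed (A N) := by
    simp only [A, Set.ofPred_forall]
    exact isClosed_iInter fun n => isClosed_iInter fun _ =>
      isClosed_le ((hf n).dist (hf N)) continuous_const
  have hcover : ⋃ N, A N = Set.univ := Set.eq_univ_of_forall fun x =>
    have ⟨N, hN⟩ := Metric.cauchySeq_iff'.mp (hF x).cauchySeq _ hε4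
    Set.mem_iUnion.mpr ⟨N, fun n hn => (hN n hn).le⟩
  have hdist (N : ℕ) {x : X} (hx : x ∈ A N) : dist (F x) (f N x) ≤ ε / 4 :=
    le_of_tendsto ((hF x).dist tendsto_const_nhds) (eventually_atTop.mpr ⟨N, hx⟩)
  obtain ⟨N, x₀, hx₀⟩ := nonempty_interior_of_iUnion_of_closed hclosed hcover
  refine ⟨x₀, ?_⟩
  filter_upwards [mem_interior_iff_mem_nhds.mp hx₀,
    Metric.tendsto_nhds.mp ((hf N).tendsto x₀) _ hε4] with x hx hfx
  have := dist_triangle4 (F x) (f N x) (f N x₀) (F x₀)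
  have := hdist N (interior_subset hx₀)
  rw [dist_comm] at this
  linarith [hdist N hx]

lemma continuous_of_tendsto_of_dist_mul_left {G Y : Type*} [Group G] [TopologicalSpace G]
    [ContinuousMul G] [BaireSpace G] [PseudoMetricSpace Y] {f : ℕ → G → Y} {F : G → Y}
    (hf : ∀ n, Continuous (f n)) (hF : ∀ g, Tendsto (fun n => f n g) atTop (𝓝 (F g)))
    (hdist : ∀ g h k, dist (F (g * h)) (F (g * k)) = dist (F h) (F k)) : Continuous F := by
  refine continuous_iff_continuousAt.mpr fun g => Metric.tendsto_nhds.mpr fun ε hε => ?_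
  obtain ⟨g₀, hg₀⟩ := exists_eventually_dist_lt_of_tendsto hf hF hε
  have htrans : Tendsto (g₀ * g⁻¹ * ·) (𝓝 g) (𝓝 g₀) := by
    simpa using (continuous_const_mul (g₀ * g⁻¹)).tendsto g
  filter_upwards [htrans.eventually hg₀] with h hh
  rwa [← hdist (g₀ * g⁻¹), inv_mul_cancel_right]

lemma exists_continuous_eventually_mem_convex {V : Type*} [AddCommGroup V] [Module ℝ V]
    [TopologicalSpace V] [ContinuousAdd V] [ContinuousSMul ℝ V] {C : ℕ → Set V}
    (hconvex : ∀ n, Convex ℝ (C n)) (hanti : Antitone C) (hne : ∀ n, (C n).Nonempty) {v : V}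
    (hv : v ∈ C 0) :
    ∃ p : ℝ≥0 → V, Continuous p ∧ p 0 = v ∧ ∀ n : ℕ, ∀ t ≥ (n : ℝ≥0), p t ∈ C n := by
  let D : ℝ≥0 → Set V := fun t => if t = 0 then {v} else C ⌊t⌋₊
  have hD (t : ℝ≥0) : Convex ℝ (D t) := by
    unfold D
    split_ifs
    exacts [convex_singleton v, hconvex _]
  have hlocal (t : ℝ≥0) : ∃ c, ∀ᶠ s in 𝓝 t, c ∈ D s := by
    rcases eq_or_ne t 0 with rfl | ht
    · refine ⟨v, (gt_mem_nhds zero_lt_one).mono fun s hs => ?_⟩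
      unfold D
      split_ifs
      exacts [rfl, by rwa [Nat.floor_eq_zero.mpr hs]]
    · obtain ⟨c, hc⟩ := hne (⌊t⌋₊ + 1)
      refine ⟨c, ?_⟩
      filter_upwards [gt_mem_nhds (Nat.lt_floor_add_one t), isOpen_ne.mem_nhds ht] with s hs hs0
      simp only [D, if_neg hs0]
      exact hanti ((Nat.floor_lt zero_le).mpr (by exact_mod_cast hs)).le hc
  obtain ⟨p, hp⟩ := exists_continuous_forall_mem_convex_of_local_const hD hlocal
  refine ⟨p, p.continuous, by simpa [D] using hp 0, fun n t hnt => ?_⟩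
  have ht := hp t
  unfold D at ht
  split_ifs at ht with h0
  · obtain rfl : n = 0 := by simpa [h0] using hnt
    rwa [Set.mem_singleton_iff.mp ht]
  · exact hanti (Nat.le_floor hnt) ht

lemma tendsto_zero_of_eventually_norm_le {ι V : Type*} [SeminormedAddCommGroup V] {l : Filter ι}
    {f : ι → V} (h : ∀ n : ℕ, ∀ᶠ i in l, ‖f i‖ ≤ 1 / (n + 1)) : Tendsto f l (𝓝 0) := by
  refine tendsto_zero_iff_norm_tendsto_zero.mpr (tendsto_order.mpr
    ⟨fun a ha => .of_forall fun i => ha.trans_le (norm_nonneg _), fun a ha => ?_⟩)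
  obtain ⟨n, hn⟩ := exists_nat_one_div_lt ha
  exact (h n).mono fun i hi => hi.trans_lt hn

/-- A closed two-sided ideal of a C⋆-algebra. -/
class IsClosedIdeal {M : Type*} [CStarAlgebra M] (J : NonUnitalStarSubalgebra ℂ M) : Prop where
  isClosed : IsClosed (J : Set M)
  mul_mem_left : ∀ (x : M) {y : M}, y ∈ J → x * y ∈ J
  mul_mem_right : ∀ {y : M}, y ∈ J → ∀ x : M, y * x ∈ J

/-- A sequential approximate unit of `J` consisting of selfadjoint contractions. Selfadjointness
makes the left approximate unit two-sided. -/
structure IsApproxUnit {M : Type*} [CStarAlgebra M] (J : NonUnitalStarSubalgebra ℂ M)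
    (e : ℕ → M) : Prop where
  mem : ∀ n, e n ∈ J
  isSelfAdjoint : ∀ n, IsSelfAdjoint (e n)
  norm_le : ∀ n, ‖e n‖ ≤ 1
  tendsto_mul_right : ∀ b ∈ J, Tendsto (fun n => e n * b) atTop (𝓝 b)

/-- An action of `G` on `M` by ⋆-automorphisms that leaves `J` invariant and is point-norm
continuous on `J`; no continuity is assumed on `M`. -/
structure IdealAction (G : Type*) [Group G] [TopologicalSpace G] {M : Type*} [CStarAlgebra M]
    (J : NonUnitalStarSubalgebra ℂ M) where
  aut : G →* (M ≃⋆ₐ[ℂ] M)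
  map_mem : ∀ g {b}, b ∈ J → aut g b ∈ J
  continuous_orbit : ∀ b ∈ J, Continuous fun g => aut g b

section Ideal

variable {M : Type*} [CStarAlgebra M] {J : NonUnitalStarSubalgebra ℂ M}

open NormedSpace in
lemma IsClosedIdeal.exp_sub_exp_mem [IsClosedIdeal J] {x y : M} (h : x - y ∈ J) :
    exp x - exp y ∈ J := by
  have hpow (n : ℕ) : x ^ n - y ^ n ∈ J := by
    induction n with
    | zero => simp
    | succ n ih =>
      have hsplit : x ^ (n + 1) - y ^ (n + 1) = x * (x ^ n - y ^ n) + (x - y) * y ^ n := by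
        rw [pow_succ', pow_succ']
        noncomm_ring
      rw [hsplit]
      exact add_mem (mul_mem_left x ih) (mul_mem_right h _)
  have hsum := (exp_series_hasSum_exp' (𝕂 := ℂ) x).sub (exp_series_hasSum_exp' (𝕂 := ℂ) y)
  refine isClosed.mem_of_tendsto hsum (Eventually.of_forall fun s => sum_mem fun n _ => ?_)
  rw [← smul_sub]
  exact SMulMemClass.smul_mem _ (hpow n)

lemma norm_one_sub_le {f : M} (hf : ‖f‖ ≤ 1) : ‖1 - f‖ ≤ 2 := by
  have hone : ‖(1 : M)‖ ≤ 1 := IsStarProjection.norm_le 1 (.one M)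
  linarith [norm_sub_le 1 f]

namespace IsApproxUnit

variable {e : ℕ → M} (he : IsApproxUnit J e)
include he

lemma tendsto_mul_left {b : M} (hb : b ∈ J) : Tendsto (fun n => b * e n) atTop (𝓝 b) := by
  simpa [(he.isSelfAdjoint _).star_eq] using (he.tendsto_mul_right _ (star_mem hb)).star

lemma tendsto_one_sub_mul {b : M} (hb : b ∈ J) :
    Tendsto (fun n => (1 - e n) * b) atTop (𝓝 0) := by
  simpa [sub_mul] using (he.tendsto_mul_right b hb).const_sub b

lemma norm_one_sub_le (n : ℕ) : ‖1 - e n‖ ≤ 2 :=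
  CocycleRepresentations.norm_one_sub_le (he.norm_le n)

end IsApproxUnit

lemma tendsto_one_sub_mul_of_tendsto_approxUnit {ι : Type*} {l : Filter ι} {p : ι → M}
    (hp : ∀ i, ‖p i‖ ≤ 1) {e : ℕ → M} (he : IsApproxUnit J e)
    (h : ∀ n, Tendsto (fun i => (1 - p i) * e n) l (𝓝 0)) {b : M} (hb : b ∈ J) :
    Tendsto (fun i => (1 - p i) * b) l (𝓝 0) := by
  have hlip (i : ι) : LipschitzWith 2 fun b => (1 - p i) * b :=
    LipschitzWith.of_dist_le_mul fun b b' => by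
      rw [dist_eq_norm, dist_eq_norm, ← mul_sub]
      exact norm_mul_le_of_le (norm_one_sub_le (hp i)) le_rfl
  have hclosed := (LipschitzWith.uniformEquicontinuous _ _ hlip).equicontinuous
    |>.isClosed_setOfPred_tendsto (l := l) (continuous_const (y := (0 : M)))
  refine hclosed.mem_of_tendsto (he.tendsto_mul_right b hb) (Eventually.of_forall fun n => ?_)
  simpa [mul_assoc] using (h n).mul_const b

/-- The twisted commutator `x ↦ x y - y σ(x)`. For `σ = id` it measures the failure of `x` to
commute with `y`, for `y = 1` the failure of `x` to be fixed by `σ`. -/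
def twistedCommutator (σ : M ≃⋆ₐ[ℂ] M) (y : M) : M →ₗ[ℂ] M where
  toFun x := x * y - y * σ x
  map_add' x x' := by simp only [map_add]; noncomm_ring
  map_smul' c x := by simp [smul_sub]

lemma twistedCommutator_apply (σ : M ≃⋆ₐ[ℂ] M) (y x : M) :
    twistedCommutator σ y x = x * y - y * σ x := rfl

lemma twistedCommutator_mul (σ : M ≃⋆ₐ[ℂ] M) (y x x' : M) :
    twistedCommutator σ y (x * x') =
      x * twistedCommutator σ y x' + twistedCommutator σ y x * σ x' := by
  simp only [twistedCommutator_apply, map_mul]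
  noncomm_ring

lemma norm_apply_eq (σ : M ≃⋆ₐ[ℂ] M) (x : M) : ‖σ x‖ = ‖x‖ :=
  NonUnitalStarAlgHom.norm_map σ σ.injective x

lemma norm_twistedCommutator_le (σ : M ≃⋆ₐ[ℂ] M) (y x : M) :
    ‖twistedCommutator σ y x‖ ≤ 2 * ‖x‖ * ‖y‖ := by
  calc ‖x * y - y * σ x‖ ≤ ‖x‖ * ‖y‖ + ‖y‖ * ‖σ x‖ :=
        (norm_sub_le _ _).trans (add_le_add (norm_mul_le _ _) (norm_mul_le _ _))
    _ = 2 * ‖x‖ * ‖y‖ := by rw [norm_apply_eq]; ring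

open NormedSpace CStarAlgebra in
lemma map_expUnitary {N F : Type*} [CStarAlgebra N] [FunLike F M N] [AlgHomClass F ℂ M N]
    [StarHomClass F M N] (f : F) (x : selfAdjoint M) :
    f (selfAdjoint.expUnitary x) = selfAdjoint.expUnitary ⟨f x, x.2.map f⟩ := by
  let +nondep : NormedAlgebra ℚ M := .restrictScalars ℚ ℂ M
  let +nondep : NormedAlgebra ℚ N := .restrictScalars ℚ ℂ N
  rw [selfAdjoint.expUnitary_coe, selfAdjoint.expUnitary_coe, map_exp f (map_continuous f),
    map_smul]

lemma norm_twistedCommutator_expUnitary_le (σ : M ≃⋆ₐ[ℂ] M) (y : M) (x : selfAdjoint M) :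
    ‖twistedCommutator σ y (selfAdjoint.expUnitary x : M)‖ ≤ ‖twistedCommutator σ y x‖ := by
  rw [twistedCommutator_apply, map_expUnitary]
  exact norm_expUnitary_mul_sub_mul_expUnitary_le _ _ y

lemma norm_conj_sub_conj_mul (v v' x x' : unitary M) (y : M) :
    ‖v * y * star (v' : M) - (v * x : unitary M) * y *
      star ((v' * x' : unitary M) : M)‖ = ‖x * y - y * x'‖ := by
  have hsplit : v * y * star (v' : M) - (v * x : unitary M) * y *
      star ((v' * x' : unitary M) : M) =
      v * (y * x' - x * y) * (star (v' * x') : unitary M) := by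
    have hx' : (x' : M) * (star (x' : M) * star (v' : M)) = star (v' : M) := by
      rw [← mul_assoc, Unitary.mul_star_self_of_mem x'.2, one_mul]
    simp only [Unitary.coe_star, Submonoid.coe_mul, star_mul, mul_sub, sub_mul, mul_assoc, hx']
  rw [hsplit, CStarRing.norm_mul_coe_unitary, CStarRing.norm_coe_unitary_mul, norm_sub_rev]

end Ideal

namespace IdealAction

variable {M : Type*} [CStarAlgebra M] {J : NonUnitalStarSubalgebra ℂ M}
  {G : Type*} [Group G] [TopologicalSpace G] (γ : IdealAction G J)

lemma aut_aut_inv (g : G) (x : M) : γ.aut g (γ.aut g⁻¹ x) = x := by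
  rw [← StarAlgEquiv.mul_apply, ← map_mul, mul_inv_cancel, map_one, StarAlgEquiv.one_apply]

lemma continuous_aut_apply {X : Type*} [TopologicalSpace X] {k : X → G} (hk : Continuous k)
    {b : X → M} (hb : Continuous b) (hbJ : ∀ x, b x ∈ J) :
    Continuous fun x => γ.aut (k x) (b x) :=
  (continuous_prod_of_continuous_lipschitzWith (fun p : J × G => γ.aut p.2 p.1) 1
    (fun b => γ.continuous_orbit b b.2) fun g =>
      ((NonUnitalStarAlgHom.isometry (γ.aut g) (γ.aut g).injective).comp
        isometry_subtype_coe).lipschitz).comp ((hb.subtype_mk hbJ).prodMk hk)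

lemma continuous_aut_of_sub_mem [IsTopologicalGroup G] [BaireSpace G] [IsClosedIdeal J]
    {e : ℕ → M} (he : IsApproxUnit J e) {h : M} (hh : ∀ g, h - γ.aut g h ∈ J) :
    Continuous fun g => γ.aut g h := by
  have hcont (n : ℕ) : Continuous fun g => (h - γ.aut g h) * e n := by
    have : Continuous fun g => γ.aut g (h * γ.aut g⁻¹ (e n)) :=
      γ.continuous_aut_apply continuous_id
        (continuous_const.mul ((γ.continuous_orbit _ (he.mem n)).comp continuous_inv))
        fun g => IsClosedIdeal.mul_mem_left _ (γ.map_mem _ (he.mem n))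
    simp only [map_mul, aut_aut_inv] at this
    simp only [sub_mul]
    exact continuous_const.sub this
  have hdist (g k k' : G) : dist (h - γ.aut (g * k) h) (h - γ.aut (g * k') h) =
      dist (h - γ.aut k h) (h - γ.aut k' h) := by
    simp only [dist_eq_norm, sub_sub_sub_cancel_left, map_mul, StarAlgEquiv.mul_apply, ← map_sub,
      norm_apply_eq]
  have hsub : Continuous fun g => h - γ.aut g h :=
    continuous_of_tendsto_of_dist_mul_left hcont (fun g => he.tendsto_mul_left (hh g)) hdist
  exact ((continuous_const (y := h)).sub hsub).congr fun g => sub_sub_cancel h _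

/-- `x` asymptotically commutes with all `y ∈ S` and is asymptotically `γ`-invariant, both in the
twisted sense `x y - y γ_g(x) → 0`, locally uniformly in `g`. Taking `1 ∈ S` gives invariance, and
`g = 1` gives commutation with `S`. -/
def IsAsymptoticallyFixed (S : Set M) {ι : Type*} (l : Filter ι) (x : ι → M) : Prop :=
  ∀ y ∈ S, ∀ g₀, Tendsto (fun p : ι × G => twistedCommutator (γ.aut p.2) y (x p.1))
    (l ×ˢ 𝓝 g₀) (𝓝 0)

section AsymptoticallyFixed

variable {γ} {S : Set M} {ι : Type*} {l : Filter ι} {x x' : ι → M} {C C' : ℝ}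

namespace IsAsymptoticallyFixed

lemma one : γ.IsAsymptoticallyFixed S l fun _ => 1 := fun y _ g₀ => by
  simpa [twistedCommutator_apply] using tendsto_const_nhds

lemma sub (hx : γ.IsAsymptoticallyFixed S l x) (hx' : γ.IsAsymptoticallyFixed S l x') :
    γ.IsAsymptoticallyFixed S l fun i => x i - x' i := fun y hy g₀ => by
  simpa using (hx y hy g₀).sub (hx' y hy g₀)

lemma mul (hx : γ.IsAsymptoticallyFixed S l x) (hxC : ∀ i, ‖x i‖ ≤ C)
    (hx' : γ.IsAsymptoticallyFixed S l x') (hxC' : ∀ i, ‖x' i‖ ≤ C') :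
    γ.IsAsymptoticallyFixed S l fun i => x i * x' i := fun y hy g₀ => by
  simpa [twistedCommutator_mul] using
    (isBoundedUnder_le_mul_tendsto_zero (f := fun p : ι × G => x p.1)
      (isBoundedUnder_of ⟨C, fun p => hxC p.1⟩) (hx' y hy g₀)).add
    ((hx y hy g₀).zero_mul_isBoundedUnder_le
      (isBoundedUnder_of ⟨C', fun p => (norm_apply_eq _ _).trans_le (hxC' p.1)⟩))

lemma of_subset_closure {S₀ : Set M} (hx : γ.IsAsymptoticallyFixed S₀ l x)
    (hxC : ∀ i, ‖x i‖ ≤ C) (hS : S ⊆ closure S₀) : γ.IsAsymptoticallyFixed S l x := by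
  intro y hy g₀
  have hlip (p : ι × G) : LipschitzWith (2 * C).toNNReal
      fun y => twistedCommutator (γ.aut p.2) y (x p.1) :=
    LipschitzWith.of_dist_le' fun y y' => by
      have hsub : twistedCommutator (γ.aut p.2) y (x p.1) -
          twistedCommutator (γ.aut p.2) y' (x p.1) =
          twistedCommutator (γ.aut p.2) (y - y') (x p.1) := by
        simp only [twistedCommutator_apply]
        noncomm_ring
      rw [dist_eq_norm, dist_eq_norm, hsub]
      exact (norm_twistedCommutator_le _ _ _).trans (by gcongr; exact hxC p.1)
  exact closure_minimal (fun y hy => hx y hy g₀)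
    ((LipschitzWith.uniformEquicontinuous _ _ hlip).equicontinuous.isClosed_setOfPred_tendsto
      continuous_const) (hS hy)

lemma expUnitary {h : ι → selfAdjoint M} (hh : γ.IsAsymptoticallyFixed S l fun i => (h i : M)) :
    γ.IsAsymptoticallyFixed S l fun i => (selfAdjoint.expUnitary (h i) : M) := fun y hy g₀ =>
  squeeze_zero_norm (fun _ => norm_twistedCommutator_expUnitary_le _ _ _)
    (tendsto_zero_iff_norm_tendsto_zero.mp (hh y hy g₀))

lemma mul_const_mul (hx : γ.IsAsymptoticallyFixed S l x) (hxC : ∀ i, ‖x i‖ ≤ C)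
    (hxJ : ∀ b ∈ J, Tendsto (fun i => x i * b) l (𝓝 0)) {h : M}
    (hcont : Continuous fun g => γ.aut g h)
    (hJ : ∀ y ∈ S, ∀ g, twistedCommutator (γ.aut g) y h ∈ J) :
    γ.IsAsymptoticallyFixed S l fun i => x i * h * x i := fun y hy g₀ => by
  have hmid : Tendsto (fun p : ι × G => x p.1 * twistedCommutator (γ.aut p.2) y h)
      (l ×ˢ 𝓝 g₀) (𝓝 0) :=
    tendsto_mul_of_isBoundedUnder (isBoundedUnder_of ⟨C, hxC⟩)
      (continuous_const.sub (continuous_const.mul hcont)).continuousAt (hxJ _ (hJ y hy g₀))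
  have hleft : Tendsto (fun p : ι × G => twistedCommutator (γ.aut p.2) y (x p.1 * h))
      (l ×ˢ 𝓝 g₀) (𝓝 0) := by
    simpa [twistedCommutator_mul] using hmid.add ((hx y hy g₀).zero_mul_isBoundedUnder_le
      (isBoundedUnder_of ⟨‖h‖, fun p => (norm_apply_eq _ h).le⟩))
  simpa [twistedCommutator_mul _ _ (x _ * h)] using
    (isBoundedUnder_le_mul_tendsto_zero
      (isBoundedUnder_of ⟨C * ‖h‖, fun p => norm_mul_le_of_le (hxC p.1) le_rfl⟩)
      (hx y hy g₀)).add
    (hleft.zero_mul_isBoundedUnder_le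
      (isBoundedUnder_of ⟨C, fun p => (norm_apply_eq _ _).trans_le (hxC p.1)⟩))

lemma tendsto_commutator (hx : γ.IsAsymptoticallyFixed S l x) {y : M} (hy : y ∈ S) :
    Tendsto (fun i => x i * y - y * x i) l (𝓝 0) := by
  have h := (hx y hy 1).comp (tendsto_id.prodMk tendsto_const_nhds)
  simpa [Function.comp_def, twistedCommutator_apply] using h

lemma eventually_norm_twistedCommutator_lt (hx : γ.IsAsymptoticallyFixed S l x) {y : M}
    (hy : y ∈ S) {K : Set G} (hK : IsCompact K) {ε : ℝ} (hε : 0 < ε) :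
    ∀ᶠ i in l, ∀ g ∈ K, ‖twistedCommutator (γ.aut g) y (x i)‖ < ε :=
  eventually_forall_mem_of_isCompact hK
    (P := fun p : ι × G => ‖twistedCommutator (γ.aut p.2) y (x p.1)‖ < ε) fun g₀ _ =>
    (tendsto_zero_iff_norm_tendsto_zero.mp (hx y hy g₀)).eventually_lt_const hε

end IsAsymptoticallyFixed

end AsymptoticallyFixed

/-- The selfadjoint contractions `f ∈ J` that are an `ε`-unit for `E` and whose twisted commutators
with `F` over `K` are `ε`-small. -/
def quasicentralSet (E F : Set M) (K : Set G) (ε : ℝ) : Set M :=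
  {f | f ∈ J ∧ IsSelfAdjoint f ∧ ‖f‖ ≤ 1 ∧ (∀ b ∈ E, ‖(1 - f) * b‖ ≤ ε) ∧
    ∀ y ∈ F, ∀ g ∈ K, ‖twistedCommutator (γ.aut g) y f‖ ≤ ε}

lemma quasicentralSet_mono {E E' F F' : Set M} {K K' : Set G} {ε ε' : ℝ} (hE : E ⊆ E')
    (hF : F ⊆ F') (hK : K ⊆ K') (hε : ε ≤ ε') :
    γ.quasicentralSet E' F' K' ε ⊆ γ.quasicentralSet E F K ε' :=
  fun _ ⟨hJ, hsa, hle, hfE, hfF⟩ => ⟨hJ, hsa, hle, fun b hb => (hfE b (hE hb)).trans hε,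
    fun y hy g hg => (hfF y (hF hy) g (hK hg)).trans hε⟩

lemma convex_quasicentralSet (E F : Set M) (K : Set G) (ε : ℝ) :
    Convex ℝ (γ.quasicentralSet E F K ε) := by
  rintro f ⟨hJ, hsa, hle, hE, hF⟩ f' ⟨hJ', hsa', hle', hE', hF'⟩ s t hs ht hst
  have hnorm {z z' : M} {r : ℝ} (hz : ‖z‖ ≤ r) (hz' : ‖z'‖ ≤ r) : ‖s • z + t • z'‖ ≤ r := by
    simpa using convex_closedBall (0 : M) r (by simpa using hz) (by simpa using hz') hs ht hst
  refine ⟨?_,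
    ((IsSelfAdjoint.all s).smul hsa).add ((IsSelfAdjoint.all t).smul hsa'), hnorm hle hle',
    fun b hb => ?_, fun y hy g hg => ?_⟩
  · rw [← Complex.coe_smul, ← Complex.coe_smul]
    exact add_mem (SMulMemClass.smul_mem _ hJ) (SMulMemClass.smul_mem _ hJ')
  · have hsplit : (1 - (s • f + t • f')) * b = s • ((1 - f) * b) + t • ((1 - f') * b) := by
      have hone : (1 : M) = s • 1 + t • 1 := by rw [← add_smul, hst, one_smul]
      nth_rw 1 [hone]
      simp only [sub_mul, add_mul, smul_mul_assoc, smul_sub]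
      abel
    rw [hsplit]
    exact hnorm (hE b hb) (hE' b hb)
  · rw [map_add, LinearMap.map_smul_of_tower, LinearMap.map_smul_of_tower]
    exact hnorm (hF y hy g hg) (hF' y hy g hg)

lemma tendsto_star_twistedCommutator_mul [IsTopologicalGroup G] [IsClosedIdeal J] {e : ℕ → M}
    (he : IsApproxUnit J e) (y : M) {c : G → M} (hc : Continuous c) (hcJ : ∀ g, c g ∈ J) (g₀ : G) :
    Tendsto (fun p : ℕ × G => star (twistedCommutator (γ.aut p.2) y (e p.1)) * c p.2)
      (atTop ×ˢ 𝓝 g₀) (𝓝 0) := by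
  have hbdd : IsBoundedUnder (· ≤ ·) atTop fun n => ‖1 - e n‖ :=
    isBoundedUnder_of ⟨2, he.norm_one_sub_le⟩
  have hyc : Continuous fun g => star y * c g := continuous_const.mul hc
  have hycJ (g : G) : star y * c g ∈ J := IsClosedIdeal.mul_mem_left _ (hcJ g)
  have htwist : Continuous fun g => γ.aut g⁻¹ (star y * c g) :=
    γ.continuous_aut_apply continuous_inv hyc hycJ
  have hleft := tendsto_mul_of_isBoundedUnder hbdd hc.continuousAt
    (he.tendsto_one_sub_mul (hcJ g₀))
  have hright := tendsto_mul_of_isBoundedUnder hbdd htwist.continuousAt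
    (he.tendsto_one_sub_mul (γ.map_mem _ (hycJ g₀)))
  have hsum : Tendsto (fun p : ℕ × G => ‖(1 - e p.1) * γ.aut p.2⁻¹ (star y * c p.2)‖ +
      ‖y‖ * ‖(1 - e p.1) * c p.2‖) (atTop ×ˢ 𝓝 g₀) (𝓝 0) := by
    simpa only [norm_zero, mul_zero, add_zero] using hright.norm.add (hleft.norm.const_mul ‖y‖)
  refine squeeze_zero_norm (fun p => ?_) hsum
  have hsplit : star (twistedCommutator (γ.aut p.2) y (e p.1)) * c p.2 =
      γ.aut p.2 ((1 - e p.1) * γ.aut p.2⁻¹ (star y * c p.2)) -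
        star y * ((1 - e p.1) * c p.2) := by
    simp only [twistedCommutator_apply, star_sub, star_mul, ← map_star,
      (he.isSelfAdjoint _).star_eq, map_mul, map_sub, map_one, aut_aut_inv]
    noncomm_ring
  rw [hsplit]
  refine (norm_sub_le _ _).trans (add_le_add (norm_apply_eq _ _).le ?_)
  exact (norm_mul_le _ _).trans_eq (by rw [norm_star])

/-- The twisted commutators of an approximate unit are nearly orthogonal along a subsequence, so
that their averages are small. -/
lemma quasicentralSet_nonempty [IsTopologicalGroup G] [IsClosedIdeal J] {e : ℕ → M}
    (he : IsApproxUnit J e) {E F : Set M} (hE : E.Finite) (hEJ : E ⊆ J) (hF : F.Finite)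
    {K : Set G} (hK : IsCompact K) {ε : ℝ} (hε : 0 < ε) : (γ.quasicentralSet E F K ε).Nonempty := by
  obtain ⟨N₀, hN₀⟩ : ∃ N₀, ∀ n ≥ N₀, ∀ b ∈ E, ‖(1 - e n) * b‖ ≤ ε := by
    refine eventually_atTop.mp (hE.eventually_all.mpr fun b hb => ?_)
    exact (tendsto_zero_iff_norm_tendsto_zero.mp
      (he.tendsto_one_sub_mul (hEJ hb))).eventually_le_const hε
  obtain ⟨C, hC⟩ := hF.isBounded.exists_norm_le
  let T (p : M × G) : M →ₗ[ℝ] M := (twistedCommutator (γ.aut p.2) p.1).restrictScalars ℝ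
  have hTC : ∀ p ∈ F ×ˢ K, ∀ n, ‖T p (e n)‖ ≤ 2 * 1 * C := fun p hp n =>
    (norm_twistedCommutator_le _ _ _).trans (by gcongr; exacts [he.norm_le n, hC _ hp.1])
  have horth (m : ℕ) (δ : ℝ) (hδ : 0 < δ) :
      ∀ᶠ n in atTop, ∀ p ∈ F ×ˢ K, ‖star (T p (e n)) * T p (e m)‖ ≤ δ := by
    have hy : ∀ y ∈ F, ∀ᶠ n in atTop, ∀ g ∈ K, ‖star (T (y, g) (e n)) * T (y, g) (e m)‖ ≤ δ :=
      fun y _ => eventually_forall_mem_of_isCompact hK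
        (P := fun p => ‖star (T (y, p.2) (e p.1)) * T (y, p.2) (e m)‖ ≤ δ) fun g₀ _ =>
          (tendsto_zero_iff_norm_tendsto_zero.mp <| γ.tendsto_star_twistedCommutator_mul he y
            (continuous_const.sub (continuous_const.mul (γ.continuous_orbit _ (he.mem m))))
            (fun g => sub_mem (IsClosedIdeal.mul_mem_right (he.mem m) y)
              (IsClosedIdeal.mul_mem_left y (γ.map_mem g (he.mem m)))) g₀).eventually_le_const hδ
    filter_upwards [hF.eventually_all.mpr hy] with n hn p hp using hn p.1 hp.1 p.2 hp.2
  obtain ⟨f, hf, hfT⟩ := exists_mem_convexHull_forall_norm_le hTC horth N₀ hε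
  obtain ⟨hJ, hsa, hle, hfE, -⟩ : f ∈ γ.quasicentralSet E ∅ ∅ ε :=
    convexHull_min (by
      rintro _ ⟨n, hn, rfl⟩
      exact ⟨he.mem n, he.isSelfAdjoint n, he.norm_le n, hN₀ n hn, by simp⟩)
      (γ.convex_quasicentralSet E ∅ ∅ ε) hf
  exact ⟨f, hJ, hsa, hle, hfE, fun y hy g hg => hfT (y, g) ⟨hy, hg⟩⟩

/-- A path of selfadjoint contractions in `J` from `0` that is asymptotically a unit for `J` and
asymptotically fixed. -/
structure IsQuasicentralPath (S : Set M) (p : ℝ≥0 → M) : Prop where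
  continuous : Continuous p
  map_zero : p 0 = 0
  mem : ∀ t, p t ∈ J
  isSelfAdjoint : ∀ t, IsSelfAdjoint (p t)
  norm_le : ∀ t, ‖p t‖ ≤ 1
  tendsto_one_sub_mul : ∀ b ∈ J, Tendsto (fun t => (1 - p t) * b) atTop (𝓝 0)
  isAsymptoticallyFixed : γ.IsAsymptoticallyFixed S atTop p

lemma exists_isQuasicentralPath [IsTopologicalGroup G] [WeaklyLocallyCompactSpace G]
    [SigmaCompactSpace G] [IsClosedIdeal J] {e : ℕ → M} (he : IsApproxUnit J e) {S : Set M}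
    (hS : TopologicalSpace.IsSeparable S) : ∃ p, γ.IsQuasicentralPath S p := by
  obtain ⟨c, hc, hSc⟩ := hS
  obtain ⟨y, hy⟩ := (hc.insert 0).exists_eq_range (Set.insert_nonempty _ _)
  let K : CompactExhaustion G := default
  let Q (n : ℕ) : Set M :=
    γ.quasicentralSet (e '' Set.Iio n) (y '' Set.Iio n) (K n) (1 / (n + 1))
  have hanti : Antitone Q := fun m n hmn => γ.quasicentralSet_mono
    (Set.image_mono (Set.Iio_subset_Iio hmn)) (Set.image_mono (Set.Iio_subset_Iio hmn))
    (K.subset hmn) (Nat.one_div_le_one_div hmn)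
  have hne (n : ℕ) : (Q n).Nonempty := γ.quasicentralSet_nonempty he
    ((Set.finite_Iio n).image e) (Set.image_subset_iff.mpr fun m _ => he.mem m)
    ((Set.finite_Iio n).image y) (K.isCompact n) Nat.one_div_pos_of_nat
  have hzero : (0 : M) ∈ Q 0 := ⟨zero_mem J, .zero M, by simp, by simp, by simp⟩
  obtain ⟨p, hpcont, hp0, hpQ⟩ := exists_continuous_eventually_mem_convex
    (fun n => γ.convex_quasicentralSet _ _ _ _) hanti hne hzero
  have hpQ' (n : ℕ) : ∀ᶠ t in atTop, p t ∈ Q n := (eventually_ge_atTop (n : ℝ≥0)).mono (hpQ n)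
  have hle (t : ℝ≥0) : ‖p t‖ ≤ 1 := (hpQ 0 t (by simp)).2.2.1
  have hunit (m : ℕ) : Tendsto (fun t => (1 - p t) * e m) atTop (𝓝 0) :=
    tendsto_zero_of_eventually_norm_le fun n => by
      filter_upwards [hpQ' (max n (m + 1))] with t ht
      exact (ht.2.2.2.1 _ ⟨m, by simp, rfl⟩).trans
        (Nat.one_div_le_one_div (le_max_left _ _))
  have hfixed : γ.IsAsymptoticallyFixed (Set.range y) atTop p := by
    rintro _ ⟨m, rfl⟩ g₀
    obtain ⟨k, hk⟩ := K.exists_mem_nhds g₀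
    refine tendsto_zero_of_eventually_norm_le fun n => ?_
    filter_upwards [(hpQ' (max n (max (m + 1) k))).prod_mk hk] with q hq
    exact (hq.1.2.2.2.2 _ ⟨m, by simp, rfl⟩ q.2
      (K.subset ((le_max_right _ _).trans (le_max_right _ _)) hq.2)).trans
      (Nat.one_div_le_one_div (le_max_left _ _))
  exact ⟨p, hpcont, hp0, fun t => (hpQ 0 t (by simp)).1, fun t => (hpQ 0 t (by simp)).2.1, hle,
    fun b hb => tendsto_one_sub_mul_of_tendsto_approxUnit hle he hunit hb,
    hfixed.of_subset_closure hle
      (hSc.trans (closure_mono ((Set.subset_insert 0 c).trans hy.le)))⟩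

/-- The unitaries `w` that are the initial point of an asymptotically fixed path of unitaries in
`w + J`. -/
def deformableUnitaries [IsClosedIdeal J] (S : Set M) : Submonoid (unitary M) where
  carrier := {w | ∃ x : ℝ≥0 → unitary M, Continuous x ∧ x 0 = w ∧ (∀ t, (x t - w : M) ∈ J) ∧
    γ.IsAsymptoticallyFixed S atTop fun t => (x t : M)}
  one_mem' := ⟨fun _ => 1, continuous_const, rfl, fun _ => by simp, .one⟩
  mul_mem' := by
    rintro v w ⟨x, hxc, rfl, hxJ, hx⟩ ⟨y, hyc, rfl, hyJ, hy⟩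
    have hnorm (u : unitary M) : ‖(u : M)‖ ≤ ‖(1 : M)‖ := by
      rw [← mul_one (u : M), CStarRing.norm_coe_unitary_mul]
    refine ⟨fun t => x t * y t, hxc.mul hyc, rfl, fun t => ?_,
      hx.mul (fun t => hnorm (x t)) hy fun t => hnorm (y t)⟩
    have hsplit : ((x t * y t : unitary M) - (x 0 * y 0 : unitary M) : M) =
        x t * (y t - y 0) + (x t - x 0) * y 0 := by
      simp only [Submonoid.coe_mul]
      noncomm_ring
    rw [hsplit]
    exact add_mem (IsClosedIdeal.mul_mem_left _ (hyJ t)) (IsClosedIdeal.mul_mem_right (hxJ t) _)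

lemma IsQuasicentralPath.expUnitary_mem_deformableUnitaries [IsClosedIdeal J]
    {γ : IdealAction G J} {S : Set M}
    {p : ℝ≥0 → M} (hp : γ.IsQuasicentralPath S p) {h : selfAdjoint M}
    (hcont : Continuous fun g => γ.aut g h)
    (hS : ∀ y ∈ S, ∀ g, twistedCommutator (γ.aut g) y h ∈ J) :
    selfAdjoint.expUnitary h ∈ γ.deformableUnitaries S := by
  let q (t : ℝ≥0) : M := 1 - p t
  have hq (t : ℝ≥0) : IsSelfAdjoint (q t) := (IsSelfAdjoint.one M).sub (hp.isSelfAdjoint t)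
  let X (t : ℝ≥0) : selfAdjoint M := ⟨q t * h * q t, h.2.conjugate_self (hq t)⟩
  have hXcont : Continuous X := by
    have := hp.continuous
    exact Continuous.subtype_mk (by fun_prop) _
  have hX : γ.IsAsymptoticallyFixed S atTop fun t => (X t : M) :=
    (IsAsymptoticallyFixed.one.sub hp.isAsymptoticallyFixed).mul_const_mul
      (fun t => norm_one_sub_le (hp.norm_le t)) hp.tendsto_one_sub_mul hcont hS
  have hXJ (t : ℝ≥0) : (X t : M) - h ∈ J := by
    have hsplit : (X t : M) - h = p t * h * p t - h * p t - p t * h := by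
      simp only [X, q]
      noncomm_ring
    rw [hsplit]
    exact sub_mem (sub_mem (IsClosedIdeal.mul_mem_left _ (hp.mem t))
      (IsClosedIdeal.mul_mem_left _ (hp.mem t))) (IsClosedIdeal.mul_mem_right (hp.mem t) _)
  refine ⟨fun t => selfAdjoint.expUnitary (X t), selfAdjoint.continuous_expUnitary.comp hXcont, ?_,
    fun t => ?_, hX.expUnitary⟩
  · exact congrArg selfAdjoint.expUnitary (Subtype.ext (by simp [X, q, hp.map_zero]))
  · simp only [selfAdjoint.expUnitary_coe]
    refine IsClosedIdeal.exp_sub_exp_mem ?_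
    rw [← smul_sub]
    exact SMulMemClass.smul_mem _ (hXJ t)

end IdealAction

section Multipliers

variable {B : Type*} [NonUnitalCStarAlgebra B]

lemma isometry_coeHom : Isometry (coeHom (𝕜 := ℂ) (A := B)) :=
  AddMonoidHomClass.isometry_of_norm _ fun b => by
    rw [← norm_fst]
    exact ContinuousLinearMap.opNorm_mul_apply ℂ B b

lemma coeHom_mem_baseIdeal (b : B) : coeHom (𝕜 := ℂ) b ∈ baseIdeal B := ⟨b, rfl⟩

instance : IsClosedIdeal (baseIdeal B) where
  isClosed := by
    rw [baseIdeal, NonUnitalStarAlgHom.coe_range]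
    exact isometry_coeHom.isClosedEmbedding.isClosed_range
  mul_mem_left x _ hy := mul_mem_baseIdeal x hy
  mul_mem_right hy x := mem_baseIdeal_mul hy x

lemma exists_isApproxUnit (hB : IsSigmaUnital B) : ∃ e, IsApproxUnit (baseIdeal B) e := by
  let := CStarAlgebra.spectralOrder B
  have := CStarAlgebra.spectralOrderedRing B
  obtain ⟨e, -, he, hlim⟩ := hB
  refine ⟨fun n => coeHom (𝕜 := ℂ) (e n), fun n => coeHom_mem_baseIdeal _,
    fun n => (IsSelfAdjoint.of_nonneg (he n).1).map _,
    fun n => (isometry_coeHom.norm_map_of_map_zero (map_zero _) _).trans_le (he n).2, ?_⟩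
  rintro _ ⟨b, rfl⟩
  exact ((isometry_coeHom.continuous.tendsto b).comp (hlim b).1).congr fun n => map_mul _ _ _

lemma mul_coeHom (x : 𝓜(ℂ, B)) (b : B) : x * coeHom (𝕜 := ℂ) b = coeHom (𝕜 := ℂ) (x.fst b) := by
  refine multiplier_ext (fun c => ?_) fun c => x.central c b
  have hfaithful : ∀ d, d * (x.fst (b * c) - x.fst b * c) = 0 := fun d => by
    rw [mul_sub, ← mul_assoc, ← x.central, ← x.central, mul_assoc, sub_self]
  exact sub_eq_zero.mp (CStarRing.star_mul_self_eq_zero_iff _ |>.mp (hfaithful _))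

lemma multiplierExt_one (x : 𝓜(ℂ, B)) : multiplierExt (1 : B ≃⋆ₐ[ℂ] B) x = x := rfl

lemma multiplierExt_mul (σ τ : B ≃⋆ₐ[ℂ] B) (x : 𝓜(ℂ, B)) :
    multiplierExt (σ * τ) x = multiplierExt σ (multiplierExt τ x) := rfl

lemma multiplierExt_coeHom (σ : B ≃⋆ₐ[ℂ] B) (b : B) :
    multiplierExt σ (coeHom (𝕜 := ℂ) b) = coeHom (𝕜 := ℂ) (σ b) :=
  multiplier_ext
    (fun c => show σ (b * σ.symm c) = σ b * c by rw [map_mul, StarAlgEquiv.apply_symm_apply])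
    (fun c => show σ (σ.symm c * b) = c * σ b by rw [map_mul, StarAlgEquiv.apply_symm_apply])

lemma unitizationToMultiplier_apply (x : Unitization ℂ B) :
    unitizationToMultiplier B x = algebraMap ℂ _ x.fst + coeHom (𝕜 := ℂ) x.snd := rfl

lemma unitization_ext {x y : Unitization ℂ B} (hfst : x.fst = y.fst)
    (h : unitizationToMultiplier B x = unitizationToMultiplier B y) : x = y := by
  rw [unitizationToMultiplier_apply, unitizationToMultiplier_apply, hfst, add_right_inj] at h
  exact Unitization.ext hfst (isometry_coeHom.injective h)

lemma exists_continuous_unitization_lift {X : Type*} [TopologicalSpace X]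
    {x : X → unitary 𝓜(ℂ, B)} (hx : Continuous x)
    (hxJ : ∀ t, (x t : 𝓜(ℂ, B)) - 1 ∈ baseIdeal B) :
    ∃ w : X → unitary (Unitization ℂ B), Continuous w ∧ (∀ t, w t ∈ unitariesOnePlus B) ∧
      ∀ t, unitizationToMultiplier B (w t) = x t := by
  choose b hb using hxJ
  let z (t : X) : Unitization ℂ B := 1 + b t
  have hz (t : X) : unitizationToMultiplier B (z t) = x t := by
    simp only [unitizationToMultiplier_apply, z, Unitization.fst_add, Unitization.fst_one,
      Unitization.fst_inr, Unitization.snd_add, Unitization.snd_one, Unitization.snd_inr, add_zero,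
      zero_add, map_one]
    exact add_eq_of_eq_sub' (hb t)
  have hunitary (t : X) : z t ∈ unitary (Unitization ℂ B) :=
    ⟨unitization_ext (by simp [z]) <| by
      rw [map_mul, map_star, hz, map_one]; exact Unitary.coe_star_mul_self (x t),
    unitization_ext (by simp [z]) <| by
      rw [map_mul, map_star, hz, map_one]; exact Unitary.coe_mul_star_self (x t)⟩
  have hbcont : Continuous b :=
    isometry_coeHom.isEmbedding.continuous_iff.mpr <|
      ((continuous_subtype_val.comp hx).sub continuous_const).congr fun t => (hb t).symm
  exact ⟨fun t => ⟨z t, hunitary t⟩, (continuous_const.add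
    (Unitization.isometry_inr.continuous.comp hbcont)).subtype_mk _,
    fun t => by simp [unitariesOnePlus, z], hz⟩

end Multipliers

namespace CocycleRep

variable {G : Type*} [Group G] [TopologicalSpace G] {A : Type*} [NonUnitalCStarAlgebra A]
  {B : Type*} [NonUnitalCStarAlgebra B] {α : ContAction G A} {β : ContAction G B}
  (ρ : CocycleRep α β)

lemma coc_one : ρ.coc 1 = 1 := by
  have h := ρ.coc_mul 1 1
  rw [mul_one, map_one, multiplierExt_one] at h
  exact left_eq_mul.mp (Subtype.ext h)

lemma perturbed_one (x : 𝓜(ℂ, B)) : ρ.perturbed 1 x = x := by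
  simp [perturbed, coc_one, multiplierExt_one]

lemma perturbed_mul_apply (g h : G) (x : 𝓜(ℂ, B)) :
    ρ.perturbed (g * h) x = ρ.perturbed g (ρ.perturbed h x) := by
  simp only [perturbed, ρ.coc_mul, map_mul, multiplierExt_mul, map_star, star_mul, mul_assoc]

lemma perturbed_coeHom (g : G) (b : B) :
    ρ.perturbed g (coeHom (𝕜 := ℂ) b) =
      ρ.coc g * coeHom (𝕜 := ℂ) (β.aut g b) * star (ρ.coc g : 𝓜(ℂ, B)) := by
  rw [perturbed, multiplierExt_coeHom]

lemma continuous_coc_mul_apply {y : G → 𝓜(ℂ, B)} (hy : Continuous y)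
    (hyJ : ∀ g, y g ∈ baseIdeal B) : Continuous fun g => (ρ.coc g : 𝓜(ℂ, B)) * y g := by
  refine (continuous_prod_of_continuous_lipschitzWith
    (fun p : baseIdeal B × G => (ρ.coc p.2 : 𝓜(ℂ, B)) * p.1) 1 ?_ fun g =>
      LipschitzWith.of_dist_le_mul fun y y' => ?_).comp ((hy.subtype_mk hyJ).prodMk continuous_id)
  · rintro ⟨_, b, rfl⟩
    exact (isometry_coeHom.continuous.comp (ρ.continuous_coc_mul b)).congr
      fun g => (mul_coeHom _ b).symm
  · rw [dist_eq_norm, ← mul_sub, CStarRing.norm_coe_unitary_mul, NNReal.coe_one, one_mul,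
      Subtype.dist_eq, dist_eq_norm]

lemma continuous_perturbed_coeHom (b : B) :
    Continuous fun g => ρ.perturbed g (coeHom (𝕜 := ℂ) b) := by
  have hmul : Continuous fun g => (ρ.coc g : 𝓜(ℂ, B)) * coeHom (𝕜 := ℂ) (β.aut g b) :=
    ρ.continuous_coc_mul_apply (isometry_coeHom.continuous.comp (β.continuous_orbit b))
      fun g => coeHom_mem_baseIdeal _
  refine (ρ.continuous_coc_mul_apply hmul.star fun g =>
    star_mem (mul_mem_baseIdeal _ (coeHom_mem_baseIdeal _))).star.congr fun g => ?_
  rw [perturbed_coeHom, star_mul, star_star]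

/-- The cocycle perturbed action `β^u` as an action on the pair `B ⊆ M(B)`. -/
def perturbedAction : IdealAction G (baseIdeal B) where
  aut :=
    { toFun g :=
        { toFun := ρ.perturbed g
          invFun := ρ.perturbed g⁻¹
          left_inv x := by rw [← perturbed_mul_apply, inv_mul_cancel, perturbed_one]
          right_inv x := by rw [← perturbed_mul_apply, mul_inv_cancel, perturbed_one]
          map_mul' := ρ.perturbed_mul g
          map_add' := ρ.perturbed_add g
          map_star' := ρ.perturbed_star g
          map_smul' c x := by simp [perturbed] }
      map_one' := StarAlgEquiv.ext ρ.perturbed_one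
      map_mul' g h := StarAlgEquiv.ext (ρ.perturbed_mul_apply g h) }
  map_mem := by
    rintro g _ ⟨b, rfl⟩
    change ρ.perturbed g (coeHom (𝕜 := ℂ) b) ∈ baseIdeal B
    rw [perturbed_coeHom]
    exact mem_baseIdeal_mul (mul_mem_baseIdeal _ (coeHom_mem_baseIdeal _)) _
  continuous_orbit := by
    rintro _ ⟨b, rfl⟩
    exact ρ.continuous_perturbed_coeHom b

lemma perturbedAction_aut_apply (g : G) (x : 𝓜(ℂ, B)) :
    ρ.perturbedAction.aut g x = ρ.perturbed g x := rfl

instance : IsClosed (ρ.dAlg : Set 𝓜(ℂ, B)) := by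
  have hJ : IsClosed (baseIdeal B : Set 𝓜(ℂ, B)) := IsClosedIdeal.isClosed
  have hγ (g : G) : Continuous (ρ.perturbed g) :=
    (NonUnitalStarAlgHom.isometry (ρ.perturbedAction.aut g)
      (ρ.perturbedAction.aut g).injective).continuous
  have hinter : (ρ.dAlg : Set 𝓜(ℂ, B)) =
      (⋂ g : G, (fun x => x - ρ.perturbed g x) ⁻¹' baseIdeal B) ∩
        ⋂ a : A, (fun x => x * ρ.hom a - ρ.hom a * x) ⁻¹' baseIdeal B := by
    ext x
    simp only [Set.mem_inter_iff, Set.mem_iInter]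
    rfl
  rw [hinter]
  exact (isClosed_iInter fun g => hJ.preimage (continuous_id.sub (hγ g))).inter
    (isClosed_iInter fun a => hJ.preimage (by fun_prop))

/-- The inclusion of unitary groups `U(D_{(φ,u)}) ⊆ U(M(B))`. -/
def unitaryInclusion : unitary ρ.dAlg →⋆* unitary 𝓜(ℂ, B) :=
  Unitary.map (StarMonoidHom.ofClass ρ.dAlg.subtype)

variable {ρ}

lemma twistedCommutator_mem_of_mem_dAlg {x : 𝓜(ℂ, B)} (hx : x ∈ ρ.dAlg) {y : 𝓜(ℂ, B)}
    (hy : y ∈ insert 1 (Set.range ρ.hom)) (g : G) :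
    twistedCommutator (ρ.perturbedAction.aut g) y x ∈ baseIdeal B := by
  rcases hy with rfl | ⟨a, rfl⟩
  · simpa [twistedCommutator_apply, perturbedAction_aut_apply] using hx.1 g
  · have hsplit : twistedCommutator (ρ.perturbedAction.aut g) (ρ.hom a) x =
        x * ρ.hom a - ρ.hom a * x + ρ.hom a * (x - ρ.perturbed g x) := by
      rw [twistedCommutator_apply, perturbedAction_aut_apply]
      noncomm_ring
    rw [hsplit]
    exact add_mem (hx.2 a) (mul_mem_baseIdeal _ (hx.1 g))

lemma unitaryInclusion_mem_deformableUnitaries [IsTopologicalGroup G] [BaireSpace G]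
    (hB : IsSigmaUnital B) {p : ℝ≥0 → 𝓜(ℂ, B)}
    (hp : ρ.perturbedAction.IsQuasicentralPath (insert 1 (Set.range ρ.hom)) p) {w : unitary ρ.dAlg}
    (hw : w ∈ connectedComponent (1 : unitary ρ.dAlg)) :
    ρ.unitaryInclusion w ∈
      ρ.perturbedAction.deformableUnitaries (insert 1 (Set.range ρ.hom)) := by
  obtain ⟨e, he⟩ := exists_isApproxUnit hB
  rw [← pathComponent_eq_connectedComponent, Unitary.mem_pathComponentOne_iff] at hw
  obtain ⟨l, rfl⟩ := hw
  rw [map_list_prod, List.map_map]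
  refine Submonoid.list_prod_mem _ (List.forall_mem_map.mpr fun h _ => ?_)
  have hexp : ρ.unitaryInclusion (selfAdjoint.expUnitary h) =
      selfAdjoint.expUnitary ⟨ρ.dAlg.subtype h, h.2.map _⟩ :=
    Subtype.ext (map_expUnitary ρ.dAlg.subtype h)
  rw [Function.comp_apply, hexp]
  exact hp.expUnitary_mem_deformableUnitaries
    (ρ.perturbedAction.continuous_aut_of_sub_mem he (h : ρ.dAlg).2.1)
    fun y hy g => twistedCommutator_mem_of_mem_dAlg (h : ρ.dAlg).2 hy g

lemma norm_conj_coc_sub_conj_coc_mul (v x : unitary 𝓜(ℂ, B)) (g : G) :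
    ‖(v : 𝓜(ℂ, B)) * ρ.coc g * star (multiplierExt (β.aut g) v) -
        (v * x : unitary 𝓜(ℂ, B)) * ρ.coc g *
          star (multiplierExt (β.aut g) (v * x : unitary 𝓜(ℂ, B)))‖ =
      ‖twistedCommutator (ρ.perturbedAction.aut g) 1 (x : 𝓜(ℂ, B))‖ := by
  let β' : unitary 𝓜(ℂ, B) →⋆* unitary 𝓜(ℂ, B) :=
    Unitary.map (StarMonoidHom.ofClass (multiplierExt (β.aut g)))
  have hβ (u : unitary 𝓜(ℂ, B)) : multiplierExt (β.aut g) (u : 𝓜(ℂ, B)) = β' u := rfl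
  have hfactor : twistedCommutator (ρ.perturbedAction.aut g) 1 (x : 𝓜(ℂ, B)) =
      (x * ρ.coc g - ρ.coc g * multiplierExt (β.aut g) x) * star (ρ.coc g : 𝓜(ℂ, B)) := by
    rw [twistedCommutator_apply, perturbedAction_aut_apply, perturbed, sub_mul,
      mul_assoc (x : 𝓜(ℂ, B)), Unitary.mul_star_self_of_mem (ρ.coc g).2, mul_one, one_mul]
  rw [hfactor, ← Unitary.coe_star, CStarRing.norm_mul_coe_unitary, hβ, hβ, hβ, map_mul,
    norm_conj_sub_conj_mul]

lemma stronglyAsymptoticallyUnitarilyEquivalent_of_inv_mem_deformableUnitaries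
    {ρ₀ ρ₁ : CocycleRep α β} {v : unitary 𝓜(ℂ, B)}
    (hhom : ∀ a, ρ₁.hom a = v * ρ₀.hom a * star (v : 𝓜(ℂ, B)))
    (hcoc : ∀ g, (ρ₁.coc g : 𝓜(ℂ, B)) = v * ρ₀.coc g * star (multiplierExt (β.aut g) v))
    (hv : v⁻¹ ∈ ρ₀.perturbedAction.deformableUnitaries (insert 1 (Set.range ρ₀.hom))) :
    ρ₀.StronglyAsymptoticallyUnitarilyEquivalent ρ₁ := by
  obtain ⟨x, hxc, hx0, hxJ, hx⟩ := hv
  have hvxJ (t : ℝ≥0) : ((v * x t : unitary 𝓜(ℂ, B)) : 𝓜(ℂ, B)) - 1 ∈ baseIdeal B := by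
    have h := mul_mem_baseIdeal (v : 𝓜(ℂ, B)) (hxJ t)
    rwa [mul_sub, ← Submonoid.coe_mul, ← Submonoid.coe_mul, mul_inv_cancel] at h
  obtain ⟨w, hwc, hw1, hw⟩ := exists_continuous_unitization_lift (hxc.const_mul v) hvxJ
  have hw0 : w 0 = 1 := by
    refine Subtype.ext (unitization_ext ?_ ?_)
    · rw [OneMemClass.coe_one, Unitization.fst_one]
      exact hw1 0
    · rw [hw, hx0, mul_inv_cancel, OneMemClass.coe_one, OneMemClass.coe_one, map_one]
  refine ⟨w, hwc, hw1, hw0, fun a => ?_, fun K hK ε hε => ?_⟩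
  · refine tendsto_zero_iff_norm_tendsto_zero.mp
      (hx.tendsto_commutator (Set.mem_insert_of_mem _ ⟨a, rfl⟩)) |>.congr fun t => ?_
    rw [hw, hhom, norm_conj_sub_conj_mul]
  · filter_upwards [hx.eventually_norm_twistedCommutator_lt (Set.mem_insert _ _) hK hε]
      with t ht g hg
    rw [hw, hcoc, norm_conj_coc_sub_conj_coc_mul]
    exact ht g hg

end CocycleRep

end CocycleRepresentations

end

open CocycleRepresentations in
theorem corollary4p5_general
    {G : Type*} [Group G] [TopologicalSpace G] [IsTopologicalGroup G]
    [LocallyCompactSpace G] [SigmaCompactSpace G]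
    {A : Type*} [NonUnitalCStarAlgebra A]
    {B : Type*} [NonUnitalCStarAlgebra B] (hB : IsSigmaUnital B)
    (α : ContAction G A) (β : ContAction G B)
    (ρ₀ ρ₁ : CocycleRep α β) (hA : TopologicalSpace.IsSeparable (Set.range ρ₀.hom))
    (h : ρ₀.OperatorHomotopic ρ₁) :
    ρ₀.StronglyAsymptoticallyUnitarilyEquivalent ρ₁ := by
  obtain ⟨w, hw, hhom, hcoc⟩ := h
  obtain ⟨e, he⟩ := exists_isApproxUnit hB
  obtain ⟨p, hp⟩ := ρ₀.perturbedAction.exists_isQuasicentralPath he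
    (S := insert 1 (Set.range ρ₀.hom)) ((Set.finite_singleton 1).isSeparable.union hA)
  have hwinv : w⁻¹ ∈ connectedComponent (1 : unitary ρ₀.dAlg) :=
    (Subgroup.connectedComponentOfOne (unitary ρ₀.dAlg)).inv_mem hw
  refine CocycleRep.stronglyAsymptoticallyUnitarilyEquivalent_of_inv_mem_deformableUnitaries
    (v := ρ₀.unitaryInclusion w) hhom hcoc ?_
  rw [← map_inv]
  exact CocycleRep.unitaryInclusion_mem_deformableUnitaries hB hp hwinv

open CocycleRepresentations in
theorem corollary4p5
    {G : Type*} [Group G] [TopologicalSpace G] [IsTopologicalGroup G]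
    [LocallyCompactSpace G] [SecondCountableTopology G]
    {A : Type*} [NonUnitalCStarAlgebra A] [TopologicalSpace.SeparableSpace A]
    {B : Type*} [NonUnitalCStarAlgebra B] (hB : IsSigmaUnital B)
    (α : ContAction G A) (β : ContAction G B)
    (ρ₀ ρ₁ : CocycleRep α β) (h : ρ₀.OperatorHomotopic ρ₁) :
    ρ₀.StronglyAsymptoticallyUnitarilyEquivalent ρ₁ :=
  corollary4p5_general hB α β ρ₀ ρ₁ (TopologicalSpace.isSeparable_range <|
    AddMonoidHomClass.continuous_of_bound ρ₀.hom 1 fun a => by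
      simpa using NonUnitalStarAlgHom.norm_apply_le ρ₀.hom a) h
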